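/- Let $n\ge 2$, let $\Omega\subset\mathbb R^n$ be a domain (a nonempty connected open set), and let $E\subset\Omega$ be closed in $\Omega$ with $\mathcal H^{n-1}(E)<+\infty$, where $\mathcal H^{n-1}$ is $(n-1)$-dimensional Hausdorff measure. For $1\le j\le n$ write $x=(x_j,X_j)$, where $X_j\in\mathbb R^{n-1}$ consists of the coordinates of $x$ other than $x_j$, and for $A\subset\mathbb R^n$ put $A(X_j)=\{x_j\in\mathbb R : (x_j,X_j)\in A\}$. Here a function $v:U\to[-\infty,+\infty)$ on an open set $U\subset\mathbb R^n$ is called subharmonic if it is upper semicontinuous and $v(x)\le \frac{1}{|B|}\int_{B}v\,dm_n$ for every closed ball $B\subset U$ of centre $x$ and positive radius. Let $u:\Omega\setminus E\to\mathbb R$ be subharmonic and such that the following conditions hold. (i) $u\in L^1_{\mathrm{loc}}(\Omega)$ (the set $E$ is Lebesgue-null, so values on $E$ are immaterial here and in (iii)). (ii) $u\in C^2(\Omega\setminus E)$. (iii) For each $j$, $1\le j\le n$, $\frac{\partial^2u}{\partial x_j^2}\in L^1_{\mathrm{loc}}(\Omega)$. (iv) For each $j$, $1\le j\le n$, and for $\mathcal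 H^{n-1}$-almost every $X_j\in\mathbb R^{n-1}$ such that $E(X_j)$ is finite, the following holds: for each $x_j^0\in E(X_j)$ there exist sequences $(a_l)$ and $(b_l)$ in $(\Omega\setminus E)(X_j)$ with $a_l\nearrow x_j^0$ and $b_l\searrow x_j^0$ as $l\to+\infty$ such that $$\lim_{l\to+\infty}u(a_l,X_j)=\lim_{l\to+\infty}u(b_l,X_j)\in\mathbb R$$ (both limits exist) and $$-\infty<\liminf_{l\to+\infty}\frac{\partial u}{\partial x_j}(a_l,X_j)\le\limsup_{l\to+\infty}\frac{\partial u}{\partial x_j}(b_l,X_j)<+\infty .$$ Then $u$ has a subharmonic extension to $\Omega$, that is, there is a subharmonic function $v:\Omega\to[-\infty,+\infty)$ with $v=u$ on $\Omega\setminus E$. -/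

import Mathlib

open MeasureTheory Set Filter Topology

noncomputable section

namespace SubharmonicExtension

/-- The space `ℝⁿ` with its Euclidean norm. -/
abbrev Rn (n : ℕ) : Type := EuclideanSpace ℝ (Fin n)

/-- The mean value, in `[-∞, ∞]`, of an extended-real function over the closed ball `B(x, r)`:
mean of the positive part minus mean of the negative part. -/
def ballMean {n : ℕ} (v : Rn n → EReal) (x : Rn n) (r : ℝ) : EReal :=
  ((⨍⁻ y in Metric.closedBall x r, (v y).toENNReal ∂volume : ENNReal) : EReal) -
    ((⨍⁻ y in Metric.closedBall x r, (-(v y)).toENNReal ∂volume : ENNReal) : EReal)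

/-- `v : U → [-∞, ∞)` is subharmonic on the open set `U`: it is upper semicontinuous on `U` and
satisfies the sub-mean value inequality over every closed ball contained in `U`.  Values of `v`
outside `U` play no role, and the function that is identically `-∞` is allowed. -/
structure SubharmonicOn {n : ℕ} (v : Rn n → EReal) (U : Set (Rn n)) : Prop where
  lt_top : ∀ x ∈ U, v x < ⊤
  upperSemicontinuousOn : UpperSemicontinuousOn v U
  le_ballMean : ∀ x : Rn n, ∀ r : ℝ, 0 < r → Metric.closedBall x r ⊆ U → v x ≤ ballMean v x r

/-- The partial derivative `∂u/∂x_j`. -/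
def partialDeriv {n : ℕ} (j : Fin n) (u : Rn n → ℝ) (x : Rn n) : ℝ :=
  lineDeriv ℝ u x (EuclideanSpace.single j (1 : ℝ))

/-- The point `(t, X)` of `ℝ^(m+1)` with `j`-th coordinate `t` and the remaining coordinates,
in order, those of `X ∈ ℝ^m`. -/
def linePoint {m : ℕ} (j : Fin (m + 1)) (t : ℝ) (X : Rn m) : Rn (m + 1) :=
  WithLp.toLp 2 (j.insertNth (α := fun _ => ℝ) t (fun i => X i))

/-- The section `A(X) = {t ∈ ℝ : (t, X) ∈ A}` of `A` along the `j`-th coordinate. -/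
def lineSection {m : ℕ} (A : Set (Rn (m + 1))) (j : Fin (m + 1)) (X : Rn m) : Set ℝ :=
  {t | linePoint j t X ∈ A}

end SubharmonicExtension

end

namespace SubharmonicExtension

/-! Since `u` is C² and subharmonic off `E`, its pointwise Laplacian is nonnegative there. The crux
is that the distributional Laplacian on all of `Ω` is still nonnegative, i.e. that `E` carries no
negative mass.

On a line meeting `E` in finitely many points, the distributional second derivative of `u` is the
pointwise one plus, at each such point, a Dirac mass weighted by the jump of the derivative and a
multiple of δ' weighted by the jump of `u`. Finite Hausdorff measure makes almost every line of this
kind (`ae_finite_lineSection`). Integrability of the second derivative gives the first derivative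
one-sided limits, and condition (iv) removes the jump of `u` and makes the jump of the derivative
nonnegative (`integral_deriv2_mul_le`). Fubini and summation over the axes give ∫ u Δψ ≥ 0 for all
test functions ψ ≥ 0 (`integral_mul_lap_nonneg`).

To return from the weak inequality to ball means, the derivative of a radial kernel in its scale is
written as a multiple of the Laplacian of a test function. Kernel means therefore do not increase as
the kernel shrinks, and they tend to `u x` at continuity points (`le_average_closedBall`). The same
lemma, applied to a perturbation of `-u`, gives the pointwise sign of the Laplacian
(`lap_nonneg_of_subharmonicOn`). The extension takes on `E` the upper limit of `u` from `Ω \ E`;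
since ball averages depend continuously on the centre, the sub-mean value inequality survives the
limit. -/

/-! ### Distributional second derivatives on the line -/

/-- A function on an open interval with integrable derivative coincides there with a continuous
function on the whole line. -/
theorem exists_continuous_eqOn_of_integrableOn_deriv {p q : ℝ → ℝ} {α β : ℝ} (hαβ : α < β)
    (hp : ∀ x ∈ Ioo α β, HasDerivAt p (q x) x) (hq : IntegrableOn q (Ioo α β)) :
    ∃ G : ℝ → ℝ, Continuous G ∧ EqOn p G (Ioo α β) := by
  have hint : Integrable ((Ioo α β).indicator q) := by
    rwa [integrable_indicator_iff measurableSet_Ioo]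
  obtain ⟨y, hy⟩ := exists_between hαβ
  refine ⟨fun x => p y + ∫ s in y..x, (Ioo α β).indicator q s, ?_, fun x hx => ?_⟩
  · exact continuous_const.add
      (intervalIntegral.continuous_primitive (fun a b => hint.intervalIntegrable) y)
  · have hsub : uIcc y x ⊆ Ioo α β := ordConnected_Ioo.uIcc_subset hy hx
    have : ∫ s in y..x, (Ioo α β).indicator q s = ∫ s in y..x, q s :=
      intervalIntegral.integral_congr fun s hs => indicator_of_mem (hsub hs) q
    simp only [this]
    rw [intervalIntegral.integral_eq_sub_of_hasDerivAt (fun s hs => hp s (hsub hs))]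
    · ring
    · rw [intervalIntegrable_iff]
      exact hq.mono_set (uIoc_subset_uIcc.trans hsub)

/-- Distributional second derivative on the line: if `f` is `C²` off a finite set, and at each
exceptional point `f` is continuous and `f'` does not jump down along suitable sequences, then
the distribution `f''` dominates the pointwise second derivative. -/
theorem integral_deriv2_mul_le {U S : Set ℝ} {f p q φ φ1 φ2 : ℝ → ℝ} (hU : IsOpen U)
    (hS : S.Finite) (hφU : tsupport φ ⊆ U) (hφ0 : ∀ t, 0 ≤ φ t) (hc : HasCompactSupport φ)
    (h1 : ∀ t, HasDerivAt φ (φ1 t) t) (h2 : ∀ t, HasDerivAt φ1 (φ2 t) t) (h2c : Continuous φ2)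
    (hf : ∀ t ∈ U \ S, HasDerivAt f (p t) t) (hp : ∀ t ∈ U \ S, HasDerivAt p (q t) t)
    (hq : ∀ t ∈ U \ S, ContinuousAt q t)
    (hqi : ∀ t ∈ S ∩ tsupport φ, IntegrableAtFilter q (𝓝 t))
    (hi1 : Integrable (fun t => f t * φ2 t)) (hi2 : Integrable (fun t => q t * φ t))
    (hseq : ∀ t ∈ S, ∃ a b : ℕ → ℝ, (∀ l, a l ∈ U \ S) ∧ (∀ l, b l ∈ U \ S) ∧
      Monotone a ∧ Tendsto a atTop (𝓝 t) ∧ Antitone b ∧ Tendsto b atTop (𝓝 t) ∧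
      (∃ c : ℝ, Tendsto (fun l => f (a l)) atTop (𝓝 c) ∧ Tendsto (fun l => f (b l)) atTop (𝓝 c)) ∧
      liminf (fun l => ((p (a l) : ℝ) : EReal)) atTop ≤
        limsup (fun l => ((p (b l) : ℝ) : EReal)) atTop) :
    ∫ t, q t * φ t ≤ ∫ t, f t * φ2 t := by
  have e1 : φ1 = deriv φ := funext fun t => (h1 t).deriv.symm
  have e2 : φ2 = deriv φ1 := funext fun t => (h2 t).deriv.symm
  have z0 : ∀ t, t ∉ tsupport φ → φ t = 0 := fun t => image_eq_zero_of_notMem_tsupport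
  have z1 : ∀ t, t ∉ tsupport φ → φ1 t = 0 := fun t ht => by
    rw [e1]; exact image_eq_zero_of_notMem_tsupport fun h => ht (tsupport_deriv_subset h)
  have z2 : ∀ t, t ∉ tsupport φ → φ2 t = 0 := fun t ht => by
    rw [e2, e1]; exact image_eq_zero_of_notMem_tsupport
      fun h => ht (tsupport_deriv_subset (tsupport_deriv_subset h))
  have c0 : Continuous φ := continuous_iff_continuousAt.2 fun t => (h1 t).continuousAt
  have c1 : Continuous φ1 := continuous_iff_continuousAt.2 fun t => (h2 t).continuousAt
  obtain ⟨R, hR⟩ := hc.isCompact.isBounded.subset_closedBall 0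
  rw [Real.closedBall_eq_Icc] at hR
  simp only [zero_sub, zero_add] at hR
  set α := -R - 1 with hα
  have hαl : ∀ t ∈ tsupport φ, α < t := fun t ht => by have := (hR ht).1; simp only [α]; linarith
  set H : ℝ → ℝ := fun t => f t * φ2 t - q t * φ t with hH
  set B : ℝ → ℝ := fun t => f t * φ1 t - p t * φ t with hB
  have Hi : Integrable H := hi1.sub hi2
  have zH : ∀ t, t ∉ tsupport φ → H t = 0 := fun t ht => by simp [hH, z0 t ht, z2 t ht]
  have zB : ∀ t, t ∉ tsupport φ → B t = 0 := fun t ht => by simp [hB, z0 t ht, z1 t ht]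
  -- Off `S`, `B` is a primitive of `H`, so `W` is locally constant away from `S'`. It starts at 0
  -- and ends at ∫ H, so it suffices that its jumps are nonnegative.
  set W : ℝ → ℝ := fun t => (∫ s in α..t, H s) - B t with hW
  set S' := S ∩ tsupport φ with hS'
  have S'f : S'.Finite := hS.inter_of_left _
  have Wd : ∀ t, t ∉ S' → HasDerivAt W 0 t := by
    intro t ht
    have hcont : ContinuousAt H t ∧ HasDerivAt B (H t) t := by
      by_cases htφ : t ∈ tsupport φ
      · have htU : t ∈ U \ S := ⟨hφU htφ, fun h => ht ⟨h, htφ⟩⟩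
        refine ⟨((hf t htU).continuousAt.mul h2c.continuousAt).sub
          ((hq t htU).mul c0.continuousAt), ?_⟩
        refine (((hf t htU).mul (h2 t)).sub ((hp t htU).mul (h1 t))).congr_deriv ?_
        simp only [hH]; ring
      · have hn : ∀ᶠ s in 𝓝 t, s ∉ tsupport φ :=
          (isClosed_tsupport φ).isOpen_compl.mem_nhds htφ
        have eH : H =ᶠ[𝓝 t] fun _ => 0 := hn.mono zH
        have eB : B =ᶠ[𝓝 t] fun _ => 0 := hn.mono zB
        refine ⟨continuousAt_const.congr eH.symm, ?_⟩
        rw [zH t htφ]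
        exact (hasDerivAt_const t (0 : ℝ)).congr_of_eventuallyEq eB
    have := intervalIntegral.integral_hasDerivAt_right (a := α) (b := t)
      Hi.intervalIntegrable (Hi.aestronglyMeasurable.stronglyMeasurableAtFilter) hcont.1
    exact (this.sub hcont.2).congr_deriv (sub_self _)
  have Wc : ∀ x y, x ≤ y → (∀ s ∈ Icc x y, s ∉ S') → W y = W x := by
    intro x y hxy h
    exact constant_of_has_deriv_right_zero
      (fun s hs => (Wd s (h s hs)).continuousAt.continuousWithinAt)
      (fun s hs => (Wd s (h s (Ico_subset_Icc_self hs))).hasDerivWithinAt) y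
      (right_mem_Icc.2 hxy)
  have hαn : α ∉ tsupport φ := fun h => lt_irrefl _ (hαl α h)
  have Wα : W α = 0 := by simp [hW, zB α hαn]
  have key : ∀ N : ℕ, ∀ s, α ≤ s → s ∉ S' → (S' ∩ Iio s).ncard ≤ N → 0 ≤ W s := by
    intro N
    induction N with
    | zero =>
      intro s hs hsS hN
      have hem : S' ∩ Iio s = ∅ := by
        rw [← Set.ncard_eq_zero (S'f.inter_of_left _)]; omega
      rw [Wc α s hs, Wα]
      intro r hr hrS
      rcases hr.2.lt_or_eq with h | h
      · exact hem.subset ⟨hrS, h⟩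
      · exact hsS (h ▸ hrS)
    | succ N ih =>
      intro s hs hsS hN
      rcases (S' ∩ Iio s).eq_empty_or_nonempty with hem | hne
      · exact ih s hs hsS (by simp [hem])
      -- Peel off the last exceptional point `t` before `s`: `W` is constant from just after `t` up
      -- to `s`, and the induction hypothesis covers points just before `t`.
      obtain ⟨t, ⟨htS, hts⟩, hmax⟩ := Set.exists_max_image _ id (S'f.inter_of_left (Iio s)) hne
      simp only [id, mem_Iio] at hmax hts
      have htU : t ∈ U := hφU htS.2
      obtain ⟨a, b, haU, hbU, hmono, hat, hanti, hbt, ⟨c, hac, hbc⟩, hle⟩ := hseq t htS.1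
      have ha : ∀ l, a l < t := fun l => lt_of_le_of_ne (hmono.ge_of_tendsto hat l)
        fun h => (haU l).2 (h ▸ htS.1)
      have hb : ∀ l, t < b l := fun l => lt_of_le_of_ne (hanti.le_of_tendsto hbt l)
        fun h => (hbU l).2 (h ▸ htS.1)
      obtain ⟨V, hV, hVq⟩ := hqi t htS
      have hnear : ∀ᶠ r in 𝓝 t, r ∈ U ∧ r ∉ S \ {t} ∧ r ∈ V :=
        (hU.eventually_mem htU).and (((hS.subset sdiff_subset).isClosed.isOpen_compl.eventually_mem
          (by simp)).and hV)
      obtain ⟨δ, hδ, hball⟩ := Metric.eventually_nhds_iff_ball.1 hnear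
      rw [Real.ball_eq_Ioo] at hball
      have hsub : ∀ r ∈ Ioo (t - δ) (t + δ), r ≠ t → r ∈ U \ S := fun r hr hrt =>
        ⟨(hball r hr).1, fun h => (hball r hr).2.1 ⟨h, hrt⟩⟩
      -- Integrability of `q` near `t` extends `p` continuously up to `t` from each side, so the
      -- sequences `a` and `b` see the true one-sided limits `Gl t` and `Gr t`.
      obtain ⟨Gr, Grc, hGr⟩ := exists_continuous_eqOn_of_integrableOn_deriv
        (p := p) (q := q) (α := t) (β := t + δ) (by linarith)
        (fun r hr => hp r (hsub r ⟨by linarith [hr.1], hr.2⟩ hr.1.ne'))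
        (hVq.mono_set fun r hr => (hball r ⟨by linarith [hr.1], hr.2⟩).2.2)
      obtain ⟨Gl, Glc, hGl⟩ := exists_continuous_eqOn_of_integrableOn_deriv
        (p := p) (q := q) (α := t - δ) (β := t) (by linarith)
        (fun r hr => hp r (hsub r ⟨hr.1, by linarith [hr.2]⟩ hr.2.ne))
        (hVq.mono_set fun r hr => (hball r ⟨hr.1, by linarith [hr.2]⟩).2.2)
      have hpa : Tendsto (fun l => p (a l)) atTop (𝓝 (Gl t)) := by
        refine ((Glc.tendsto t).comp hat).congr' ?_
        filter_upwards [hat.eventually (lt_mem_nhds (show t - δ < t by linarith))] with l hl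
        exact (hGl ⟨hl, ha l⟩).symm
      have hpb : Tendsto (fun l => p (b l)) atTop (𝓝 (Gr t)) := by
        refine ((Grc.tendsto t).comp hbt).congr' ?_
        filter_upwards [hbt.eventually (gt_mem_nhds (show t < t + δ by linarith))] with l hl
        exact (hGr ⟨hb l, hl⟩).symm
      have hjump : Gl t ≤ Gr t := by
        have ea := ((continuous_coe_real_ereal.tendsto _).comp hpa).liminf_eq
        have eb := ((continuous_coe_real_ereal.tendsto _).comp hpb).limsup_eq
        exact EReal.coe_le_coe_iff.1 ((ea.symm.trans_le hle).trans_eq eb)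
      have hI : Tendsto (fun l => ∫ r in a l..b l, H r) atTop (𝓝 0) := by
        have hcp := intervalIntegral.continuous_primitive
          (fun x y => Hi.intervalIntegrable (a := x) (b := y)) α
        have := ((hcp.tendsto t).comp hbt).sub ((hcp.tendsto t).comp hat)
        rw [sub_self] at this
        refine this.congr fun l => ?_
        exact intervalIntegral.integral_interval_sub_left Hi.intervalIntegrable
          Hi.intervalIntegrable
      have hBa : Tendsto (fun l => B (a l)) atTop (𝓝 (c * φ1 t - Gl t * φ t)) :=
        (hac.mul ((c1.tendsto t).comp hat)).sub (hpa.mul ((c0.tendsto t).comp hat))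
      have hBb : Tendsto (fun l => B (b l)) atTop (𝓝 (c * φ1 t - Gr t * φ t)) :=
        (hbc.mul ((c1.tendsto t).comp hbt)).sub (hpb.mul ((c0.tendsto t).comp hbt))
      -- The common limit `c` of `f` cancels the `φ1` terms, leaving only the jump of `p`.
      have hWd : Tendsto (fun l => W (b l) - W (a l)) atTop (𝓝 ((Gr t - Gl t) * φ t)) := by
        have := (hI.sub hBb).add hBa
        refine (this.congr fun l => ?_).trans_eq (by congr 1; ring)
        have := intervalIntegral.integral_interval_sub_left (a := α) (b := b l) (c := a l)
          Hi.intervalIntegrable Hi.intervalIntegrable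
        simp only [hW]
        rw [← this]; ring
      refine (mul_nonneg (sub_nonneg.2 hjump) (hφ0 t)).trans (le_of_tendsto hWd ?_)
      filter_upwards [hat.eventually (lt_mem_nhds (hαl t htS.2)),
        hbt.eventually (gt_mem_nhds hts)] with l hla hlb
      have hWb : W s = W (b l) := Wc _ _ hlb.le fun r hr hrS => by
        rcases hr.2.lt_or_eq with h | h
        · exact absurd (hmax r ⟨hrS, h⟩) (not_le.2 ((hb l).trans_le hr.1))
        · exact hsS (h ▸ hrS)
      have hWa : 0 ≤ W (a l) := by
        refine ih (a l) hla.le (fun h => (haU l).2 h.1) ?_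
        have : (S' ∩ Iio (a l)).ncard < (S' ∩ Iio s).ncard := by
          refine Set.ncard_lt_ncard ⟨fun r hr => ⟨hr.1, hr.2.trans ((ha l).trans hts)⟩,
            fun h => ?_⟩ (S'f.inter_of_left _)
          exact lt_asymm (ha l) (h ⟨htS, hts⟩).2
        omega
      rw [hWb]; linarith
  have hβn : ∀ t ∈ tsupport φ, t < R + 1 := fun t ht => by linarith [(hR ht).2]
  have hβ : R + 1 ∉ tsupport φ := fun h => lt_irrefl _ (hβn _ h)
  -- The maximum covers an empty support, for which `R` may be so negative that `R + 1 < α`.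
  have hfin : 0 ≤ W (max α (R + 1)) := by
    have hn : max α (R + 1) ∉ tsupport φ := fun h => absurd (hβn _ h) (not_lt.2 (le_max_right _ _))
    exact key _ _ (le_max_left _ _) (fun h => hn h.2) le_rfl
  have hn : max α (R + 1) ∉ tsupport φ := fun h => absurd (hβn _ h) (not_lt.2 (le_max_right _ _))
  have hWI : W (max α (R + 1)) = ∫ t, H t := by
    simp only [hW, zB _ hn, sub_zero]
    refine intervalIntegral.integral_eq_integral_of_support_subset fun t ht => ?_
    have htφ : t ∈ tsupport φ := by_contra fun h => ht (zH t h)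
    exact ⟨hαl t htφ, (hβn t htφ).le.trans (le_max_right _ _)⟩
  rw [hWI, integral_sub hi1 hi2] at hfin
  linarith

/-! ### Slicing along coordinate lines -/

theorem measurePreserving_linePoint {m : ℕ} (j : Fin (m + 1)) :
    MeasurePreserving (fun z : Rn m × ℝ => linePoint j z.2 z.1) := by
  have h1 : MeasurePreserving (Prod.swap : Rn m × ℝ → ℝ × Rn m) :=
    Measure.measurePreserving_swap
  have h2 := (MeasurePreserving.id (volume : Measure ℝ)).prod
    (EuclideanSpace.volume_preserving_symm_measurableEquiv_toLp (Fin m))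
  have h3 := (volume_preserving_piFinSuccAbove (fun _ : Fin (m + 1) => ℝ) j).symm
  have h4 := EuclideanSpace.volume_preserving_symm_measurableEquiv_toLp (Fin (m + 1)) |>.symm
  exact h4.comp (h3.comp (h2.comp h1))

theorem measurableEmbedding_linePoint {m : ℕ} (j : Fin (m + 1)) :
    MeasurableEmbedding (fun z : Rn m × ℝ => linePoint j z.2 z.1) := by
  have h1 := (MeasurableEquiv.prodComm (α := Rn m) (β := ℝ)).measurableEmbedding
  have h2 := ((MeasurableEquiv.refl ℝ).prodCongr
    (MeasurableEquiv.toLp 2 (Fin m → ℝ)).symm).measurableEmbedding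
  have h3 := (MeasurableEquiv.piFinSuccAbove (fun _ : Fin (m + 1) => ℝ) j).symm.measurableEmbedding
  have h4 := (MeasurableEquiv.toLp 2 (Fin (m + 1) → ℝ)).measurableEmbedding
  exact h4.comp (h3.comp (h2.comp h1))

theorem linePoint_eq_add {m : ℕ} (j : Fin (m + 1)) (s t : ℝ) (X : Rn m) :
    linePoint j t X = linePoint j s X + (t - s) • EuclideanSpace.single j (1 : ℝ) := by
  ext i
  rcases Fin.eq_self_or_eq_succAbove j i with rfl | ⟨k, rfl⟩ <;> simp [linePoint]

theorem continuous_linePoint {m : ℕ} (j : Fin (m + 1)) (X : Rn m) :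
    Continuous (fun t => linePoint j t X) := by
  have : (fun t => linePoint j t X) =
      fun t => linePoint j 0 X + (t - 0) • EuclideanSpace.single j (1 : ℝ) :=
    funext fun t => linePoint_eq_add j 0 t X
  rw [this]; fun_prop

theorem isClosedEmbedding_linePoint {m : ℕ} (j : Fin (m + 1)) (X : Rn m) :
    IsClosedEmbedding (fun t => linePoint j t X) := by
  refine Isometry.isClosedEmbedding (Isometry.of_dist_eq fun s t => ?_)
  rw [linePoint_eq_add j t s X, dist_eq_norm, add_sub_cancel_left, norm_smul]
  simp [dist_eq_norm]

theorem hasDerivAt_comp_linePoint {m : ℕ} (j : Fin (m + 1)) {u : Rn (m + 1) → ℝ} {t : ℝ} {X : Rn m}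
    (h : DifferentiableAt ℝ u (linePoint j t X)) :
    HasDerivAt (fun s => u (linePoint j s X)) (partialDeriv j u (linePoint j t X)) t := by
  have h1 : HasLineDerivAt ℝ u (partialDeriv j u (linePoint j t X)) (linePoint j t X)
      (EuclideanSpace.single j 1) := h.lineDifferentiableAt.hasLineDerivAt
  have h2 : HasDerivAt (fun s => u (linePoint j t X + s • EuclideanSpace.single j (1 : ℝ)))
    (partialDeriv j u (linePoint j t X)) (t - t) := by rw [sub_self]; exact h1
  have := h2.comp_sub_const t t
  refine this.congr_of_eventuallyEq (Eventually.of_forall fun s => ?_)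
  simp only [← linePoint_eq_add]

theorem contDiffOn_partialDeriv {n : ℕ} {j : Fin n} {u : Rn n → ℝ} {U : Set (Rn n)} (hU : IsOpen U)
    {k l : WithTop ℕ∞} (h : ContDiffOn ℝ l u U) (hk : k + 1 ≤ l) :
    ContDiffOn ℝ k (partialDeriv j u) U := by
  have h1 : ContDiffOn ℝ k (fun x => fderiv ℝ u x (EuclideanSpace.single j 1)) U :=
    (h.fderiv_of_isOpen hU hk).clm_apply contDiffOn_const
  refine h1.congr fun x hx => ?_
  have hl : l ≠ 0 := by rintro rfl; simp at hk
  exact ((h.differentiableOn hl).differentiableAt (hU.mem_nhds hx)).lineDeriv_eq_fderiv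

theorem integrable_mul_of_locallyIntegrableOn {n : ℕ} {Ω : Set (Rn n)} {f g : Rn n → ℝ}
    (hf : LocallyIntegrableOn f Ω) (hg : Continuous g) (hgc : HasCompactSupport g)
    (hgΩ : tsupport g ⊆ Ω) : Integrable (fun x => f x * g x) := by
  have h1 : IntegrableOn f (tsupport g) := (hf.mono_set hgΩ).integrableOn_isCompact hgc
  have h2 := h1.mul_continuousOn hg.continuousOn hgc
  rw [integrableOn_iff_integrable_of_support_subset] at h2
  · exact h2
  · exact fun x hx => subset_tsupport g fun h => hx (by simp [h])

theorem tsupport_partialDeriv_subset {n : ℕ} (j : Fin n) (ψ : Rn n → ℝ) :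
    tsupport (partialDeriv j ψ) ⊆ tsupport ψ := by
  refine closure_minimal (fun x hx => ?_) (isClosed_tsupport ψ)
  by_contra h
  refine hx ?_
  have h0 : ψ =ᶠ[𝓝 x] fun _ => 0 := notMem_tsupport_iff_eventuallyEq.1 h
  rw [partialDeriv, h0.lineDeriv_eq]
  simp [lineDeriv]

/-! ### The weak inequality across the exceptional set -/

/-- On almost every line parallel to the `j`-th axis, `E` is finite and at each point of `E` the
function `u` is continuous and its derivative does not jump down, along suitable sequences. -/
def RegularOnLines {m : ℕ} (Ω E : Set (Rn (m + 1))) (j : Fin (m + 1)) (u : Rn (m + 1) → ℝ) :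
    Prop :=
  ∀ᵐ X : Rn m, (lineSection E j X).Finite ∧ ∀ t ∈ lineSection E j X, ∃ a b : ℕ → ℝ,
    (∀ l, a l ∈ lineSection (Ω \ E) j X) ∧ (∀ l, b l ∈ lineSection (Ω \ E) j X) ∧
    Monotone a ∧ Tendsto a atTop (𝓝 t) ∧ Antitone b ∧ Tendsto b atTop (𝓝 t) ∧
    (∃ c : ℝ, Tendsto (fun l => u (linePoint j (a l) X)) atTop (𝓝 c) ∧
      Tendsto (fun l => u (linePoint j (b l) X)) atTop (𝓝 c)) ∧
    liminf (fun l => ((partialDeriv j u (linePoint j (a l) X) : ℝ) : EReal)) atTop ≤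
      limsup (fun l => ((partialDeriv j u (linePoint j (b l) X) : ℝ) : EReal)) atTop

/-- Fubini reduces this to `integral_deriv2_mul_le` on almost every line in direction `j`. -/
theorem integral_partialDeriv2_mul_le {m : ℕ} {Ω E : Set (Rn (m + 1))} {j : Fin (m + 1)}
    {u ψ : Rn (m + 1) → ℝ} (hΩ : IsOpen Ω) (hE : IsOpen (Ω \ E))
    (hu : LocallyIntegrableOn u Ω)
    (hu2 : LocallyIntegrableOn (partialDeriv j (partialDeriv j u)) Ω)
    (hC2 : ContDiffOn ℝ 2 u (Ω \ E)) (hlines : RegularOnLines Ω E j u)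
    (hψ : ContDiff ℝ 2 ψ) (hψc : HasCompactSupport ψ) (hψΩ : tsupport ψ ⊆ Ω)
    (hψ0 : ∀ x, 0 ≤ ψ x) :
    ∫ x, partialDeriv j (partialDeriv j u) x * ψ x ≤
      ∫ x, u x * partialDeriv j (partialDeriv j ψ) x := by
  have hψ' := contDiffOn_partialDeriv (j := j) (k := 1) isOpen_univ hψ.contDiffOn le_rfl
  have hψ'' := contDiffOn_partialDeriv (j := j) (k := 0) isOpen_univ hψ' le_rfl
  rw [contDiffOn_univ] at hψ' hψ''
  have hu' := contDiffOn_partialDeriv (j := j) (k := 1) hE hC2 le_rfl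
  have hu'' := contDiffOn_partialDeriv (j := j) (k := 0) hE hu' le_rfl
  have hts : tsupport (partialDeriv j (partialDeriv j ψ)) ⊆ tsupport ψ :=
    (tsupport_partialDeriv_subset j _).trans (tsupport_partialDeriv_subset j _)
  have hI2 : Integrable (fun x => partialDeriv j (partialDeriv j u) x * ψ x) :=
    integrable_mul_of_locallyIntegrableOn hu2 hψ.continuous hψc hψΩ
  have hI1 : Integrable (fun x => u x * partialDeriv j (partialDeriv j ψ) x) :=
    integrable_mul_of_locallyIntegrableOn hu hψ''.continuous
      (hψc.of_isClosed_subset (isClosed_tsupport _) hts) (hts.trans hψΩ)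
  -- Integrability of the product with `ψ` says nothing about the second derivative where `ψ`
  -- vanishes. Integrability on a compact neighbourhood `K` of the support passes to almost every
  -- line and gives it near every exceptional point in the support.
  obtain ⟨K, hK, hψK, hKΩ⟩ := exists_compact_between hψc hΩ hψΩ
  have hIK : Integrable (K.indicator (partialDeriv j (partialDeriv j u))) := by
    rw [integrable_indicator_iff hK.measurableSet]
    exact (hu2.mono_set hKΩ).integrableOn_isCompact hK
  have mp := measurePreserving_linePoint j
  have me := measurableEmbedding_linePoint j
  have hI1' := (mp.integrable_comp_emb me).2 hI1
  have hI2' := (mp.integrable_comp_emb me).2 hI2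
  have hIK' := (mp.integrable_comp_emb me).2 hIK
  rw [← mp.integral_comp me, ← mp.integral_comp me]
  rw [Measure.volume_eq_prod] at hI1' hI2' hIK' ⊢
  erw [integral_prod _ hI1', integral_prod _ hI2']
  refine integral_mono_ae hI2'.integral_prod_left hI1'.integral_prod_left ?_
  filter_upwards [hlines, hI1'.prod_right_ae, hI2'.prod_right_ae, hIK'.prod_right_ae]
    with X hX h1 h2 hKX
  have hcl := continuous_linePoint j X
  have hsub : tsupport (fun t => ψ (linePoint j t X)) ⊆ (fun t => linePoint j t X) ⁻¹' tsupport ψ :=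
    tsupport_comp_subset_preimage ψ hcl
  refine integral_deriv2_mul_le (U := (fun t => linePoint j t X) ⁻¹' Ω) (S := lineSection E j X)
    (p := fun t => partialDeriv j u (linePoint j t X)) (φ := fun t => ψ (linePoint j t X))
    (φ1 := fun t => partialDeriv j ψ (linePoint j t X)) (hΩ.preimage hcl) hX.1
    (hsub.trans (preimage_mono hψΩ)) (fun t => hψ0 _)
    (hψc.comp_isClosedEmbedding (isClosedEmbedding_linePoint j X))
    (fun t => hasDerivAt_comp_linePoint j (hψ.differentiable (by simp) _))
    (fun t => hasDerivAt_comp_linePoint j (hψ'.differentiable (by simp) _))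
    (hψ''.continuous.comp hcl)
    (fun t ht => hasDerivAt_comp_linePoint j
      ((hC2.differentiableOn (by simp)).differentiableAt (hE.mem_nhds ht)))
    (fun t ht => hasDerivAt_comp_linePoint j
      ((hu'.differentiableOn (by simp)).differentiableAt (hE.mem_nhds ht)))
    (fun t ht => ContinuousAt.comp (f := fun t => linePoint j t X)
      (hu''.continuousOn.continuousAt (hE.mem_nhds ht)) hcl.continuousAt)
    (fun t ht => ?_) h1 h2 hX.2
  refine ⟨(fun t => linePoint j t X) ⁻¹' interior K,
    (isOpen_interior.preimage hcl).mem_nhds (hψK (hsub ht.2)), ?_⟩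
  have := hKX.integrableOn (s := (fun t => linePoint j t X) ⁻¹' interior K)
  refine this.congr_fun (fun t ht => ?_) (isOpen_interior.preimage hcl).measurableSet
  exact indicator_of_mem (interior_subset ht) _

/-- The Laplacian as the sum of the second partial derivatives. -/
noncomputable def lap {n : ℕ} (u : Rn n → ℝ) (x : Rn n) : ℝ := ∑ j, partialDeriv j (partialDeriv j u) x

/-- Summing the directional inequalities bounds the integral below by ∫ (Δu) ψ, whose integrand is
nonnegative off the null set `E`. -/
theorem integral_mul_lap_nonneg {m : ℕ} {Ω E : Set (Rn (m + 1))}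
    {u ψ : Rn (m + 1) → ℝ} (hΩ : IsOpen Ω) (hE : IsOpen (Ω \ E)) (hE0 : volume E = 0)
    (hu : LocallyIntegrableOn u Ω)
    (hu2 : ∀ j, LocallyIntegrableOn (partialDeriv j (partialDeriv j u)) Ω)
    (hC2 : ContDiffOn ℝ 2 u (Ω \ E)) (hlines : ∀ j, RegularOnLines Ω E j u)
    (hlap : ∀ x ∈ Ω \ E, 0 ≤ lap u x)
    (hψ : ContDiff ℝ 2 ψ) (hψc : HasCompactSupport ψ) (hψΩ : tsupport ψ ⊆ Ω)
    (hψ0 : ∀ x, 0 ≤ ψ x) :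
    0 ≤ ∫ x, u x * lap ψ x := by
  have hts : ∀ j, tsupport (partialDeriv j (partialDeriv j ψ)) ⊆ tsupport ψ := fun j =>
    (tsupport_partialDeriv_subset j _).trans (tsupport_partialDeriv_subset j _)
  have hI1 : ∀ j, Integrable (fun x => u x * partialDeriv j (partialDeriv j ψ) x) := fun j => by
    have hψ' := contDiffOn_partialDeriv (j := j) (k := 1) isOpen_univ hψ.contDiffOn le_rfl
    have hψ'' := contDiffOn_partialDeriv (j := j) (k := 0) isOpen_univ hψ' le_rfl
    rw [contDiffOn_univ] at hψ''
    exact integrable_mul_of_locallyIntegrableOn hu hψ''.continuous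
      (hψc.of_isClosed_subset (isClosed_tsupport _) (hts j)) ((hts j).trans hψΩ)
  have hI2 : ∀ j, Integrable (fun x => partialDeriv j (partialDeriv j u) x * ψ x) := fun j =>
    integrable_mul_of_locallyIntegrableOn (hu2 j) hψ.continuous hψc hψΩ
  have h1 : ∫ x, lap u x * ψ x ≤ ∫ x, u x * lap ψ x := by
    simp only [lap, Finset.sum_mul, Finset.mul_sum]
    rw [integral_finsetSum _ fun j _ => hI2 j, integral_finsetSum _ fun j _ => hI1 j]
    exact Finset.sum_le_sum fun j _ => integral_partialDeriv2_mul_le hΩ hE hu (hu2 j) hC2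
      (hlines j) hψ hψc hψΩ hψ0
  refine le_trans (integral_nonneg_of_ae ?_) h1
  filter_upwards [compl_mem_ae_iff.2 hE0] with x hx
  by_cases hxΩ : x ∈ Ω
  · exact mul_nonneg (hlap x ⟨hxΩ, hx⟩) (hψ0 x)
  · simp [image_eq_zero_of_notMem_tsupport fun h => hxΩ (hψΩ h)]

/-! ### Radial kernels: from the weak inequality to ball averages -/

theorem hasDerivAt_norm_sub_sq_line {n : ℕ} (j : Fin n) (x y : Rn n) :
    HasDerivAt (fun t : ℝ => ‖y + t • EuclideanSpace.single j (1 : ℝ) - x‖ ^ 2)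
      (2 * (y j - x j)) 0 := by
  have h : (fun t : ℝ => ‖y + t • EuclideanSpace.single j (1 : ℝ) - x‖ ^ 2) =
      fun t => ‖y - x‖ ^ 2 + t * (2 * (y j - x j)) + t ^ 2 := by
    funext t
    rw [add_sub_right_comm, norm_add_sq_real, inner_smul_right, norm_smul]
    simp [EuclideanSpace.inner_single_right]
    ring
  rw [h]
  have h1 := ((hasDerivAt_id (0 : ℝ)).mul_const (2 * (y j - x j))).const_add (‖y - x‖ ^ 2)
  exact (h1.add (hasDerivAt_pow 2 (0 : ℝ))).congr_deriv (by simp)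

/-- The form is chosen so that, for `c > 0`, the right side is a negative factor depending only on
`c` and `n` times the `c`-derivative of `c ^ n * g (c ^ 2 * ‖y - x‖ ^ 2)`. Profiles in the squared
distance stay smooth at the centre. -/
theorem lap_radial {n : ℕ} {G g g' : ℝ → ℝ} (hG : ∀ t, HasDerivAt G (-g t) t)
    (hg : ∀ t, HasDerivAt g (g' t) t) (c : ℝ) (x y : Rn n) :
    lap (fun y => G (c ^ 2 * ‖y - x‖ ^ 2)) y =
      -(4 * c ^ 4 * ‖y - x‖ ^ 2 * g' (c ^ 2 * ‖y - x‖ ^ 2) +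
        2 * n * c ^ 2 * g (c ^ 2 * ‖y - x‖ ^ 2)) := by
  have h1 : ∀ j, partialDeriv j (fun y => G (c ^ 2 * ‖y - x‖ ^ 2)) =
      fun y => -g (c ^ 2 * ‖y - x‖ ^ 2) * (c ^ 2 * (2 * (y j - x j))) := by
    intro j; funext y
    have h := (hasDerivAt_norm_sub_sq_line j x y).const_mul (c ^ 2)
    have := HasDerivAt.comp (h₂ := G) (0 : ℝ) (by simpa using hG (c ^ 2 * ‖y - x‖ ^ 2)) h
    exact this.deriv
  have h2 : ∀ j, partialDeriv j (partialDeriv j (fun y => G (c ^ 2 * ‖y - x‖ ^ 2))) y =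
      -(4 * c ^ 4 * (y j - x j) ^ 2 * g' (c ^ 2 * ‖y - x‖ ^ 2) +
        2 * c ^ 2 * g (c ^ 2 * ‖y - x‖ ^ 2)) := by
    intro j
    rw [h1]
    have h := (hasDerivAt_norm_sub_sq_line j x y).const_mul (c ^ 2)
    have hc := HasDerivAt.comp (h₂ := g) (0 : ℝ) (by simpa using hg (c ^ 2 * ‖y - x‖ ^ 2)) h
    have hl : HasDerivAt (fun t : ℝ => c ^ 2 * (2 * ((y + t • EuclideanSpace.single j (1 : ℝ)) j
        - x j))) (c ^ 2 * 2) 0 := by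
      have := ((((hasDerivAt_id (0 : ℝ)).const_add (y j)).sub_const (x j)).const_mul 2).const_mul
        (c ^ 2)
      simpa using this
    have := (hc.neg.mul hl).deriv
    simp at this
    refine Eq.trans ?_ (this.trans ?_)
    · simp [partialDeriv, lineDeriv]
      rfl
    · ring
  have hs : ∑ j, (y j - x j) ^ 2 = ‖y - x‖ ^ 2 := by
    rw [EuclideanSpace.norm_sq_eq]; simp
  simp only [lap, h2]
  rw [Finset.sum_neg_distrib, Finset.sum_add_distrib, ← Finset.sum_mul, ← Finset.mul_sum, hs]
  simp
  ring

/-- Subharmonicity in the sense of distributions, tested against `C²` functions. -/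
def WeaklySubharmonicOn {n : ℕ} (u : Rn n → ℝ) (Ω : Set (Rn n)) : Prop :=
  ∀ ψ : Rn n → ℝ, ContDiff ℝ 2 ψ → HasCompactSupport ψ → tsupport ψ ⊆ Ω → (∀ x, 0 ≤ ψ x) →
    0 ≤ ∫ x, u x * lap ψ x

theorem lap_eq_zero_of_notMem_tsupport {n : ℕ} {ψ : Rn n → ℝ} {y : Rn n} (hy : y ∉ tsupport ψ) :
    lap ψ y = 0 :=
  Finset.sum_eq_zero fun j _ => image_eq_zero_of_notMem_tsupport fun h =>
    hy (tsupport_partialDeriv_subset j _ (tsupport_partialDeriv_subset j _ h))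

/-- Turns a kernel profile into a test-function profile: `G` is the integral of `g` from `t` to 1,
which gains a derivative and vanishes where `g` does beyond 1. -/
theorem exists_contDiff_primitive {g g' : ℝ → ℝ} (hg : ∀ t, HasDerivAt g (g' t) t)
    (hg' : Continuous g') (hg0 : ∀ t, 0 ≤ g t) (hg1 : ∀ t, 1 ≤ t → g t = 0) :
    ∃ G : ℝ → ℝ, ContDiff ℝ 2 G ∧ (∀ t, HasDerivAt G (-g t) t) ∧ (∀ t, 0 ≤ G t) ∧
      ∀ t, 1 ≤ t → G t = 0 := by
  have hgc : Continuous g := continuous_iff_continuousAt.2 fun t => (hg t).continuousAt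
  have hd : ∀ t, HasDerivAt (fun t => ∫ s in t..1, g s) (-g t) t := fun t =>
    intervalIntegral.integral_hasDerivAt_left (hgc.intervalIntegrable _ _)
      hgc.stronglyMeasurable.stronglyMeasurableAtFilter hgc.continuousAt
  have hz : ∀ t, 1 ≤ t → ∫ s in t..1, g s = 0 := fun t ht => by
    rw [intervalIntegral.integral_congr (g := fun _ => 0)]
    · simp
    · intro s hs
      rw [uIcc_of_ge ht] at hs
      exact hg1 s hs.1
  refine ⟨fun t => ∫ s in t..1, g s, ?_, hd, fun t => ?_, hz⟩
  · have hg1 : ContDiff ℝ 1 g := by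
      rw [contDiff_one_iff_deriv]
      refine ⟨fun t => (hg t).differentiableAt, ?_⟩
      rwa [show deriv g = g' from funext fun t => (hg t).deriv]
    rw [show (2 : WithTop ℕ∞) = 1 + 1 by norm_num, contDiff_succ_iff_deriv]
    refine ⟨fun t => (hd t).differentiableAt, by simp, ?_⟩
    rw [show deriv (fun t => ∫ s in t..1, g s) = fun t => -g t from funext fun t => (hd t).deriv]
    exact hg1.neg
  · rcases le_total t 1 with h | h
    · exact intervalIntegral.integral_nonneg h fun s _ => hg0 s
    · exact (hz t h).ge

/-- The means of `u` against the kernels `k c`, concentrated on balls of radius `1 / c`, are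
nonincreasing for `c ≥ 1 / r`; compare `c = 1 / r` with the limit as `c` tends to infinity. -/
theorem mul_integral_radial_le {n : ℕ} {u : Rn n → ℝ} {Ω : Set (Rn n)} {x : Rn n} {r : ℝ}
    (hw : WeaklySubharmonicOn u Ω) (hu : LocallyIntegrableOn u Ω) (hr : 0 < r)
    (hB : Metric.closedBall x r ⊆ Ω) (hcx : ContinuousAt u x) {g g' : ℝ → ℝ}
    (hg : ∀ t, HasDerivAt g (g' t) t) (hg'c : Continuous g') (hg0 : ∀ t, 0 ≤ g t)
    (hg1 : ∀ t, 1 ≤ t → g t = 0) (hI : 0 < ∫ y : Rn n, g (‖y‖ ^ 2)) :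
    u x * ∫ y : Rn n, g (‖y‖ ^ 2) ≤
      ∫ y, (r⁻¹ ^ n * g (r⁻¹ ^ 2 * ‖y - x‖ ^ 2)) * (Metric.closedBall x r).indicator u y := by
  have hgc : Continuous g := continuous_iff_continuousAt.2 fun t => (hg t).continuousAt
  obtain ⟨G, hG2, hGd, hG0, hG1⟩ := exists_contDiff_primitive hg hg'c hg0 hg1
  set w := (Metric.closedBall x r).indicator u with hwdef
  have hwi : Integrable w := by
    rw [hwdef, integrable_indicator_iff Metric.isClosed_closedBall.measurableSet]
    exact (hu.mono_set hB).integrableOn_isCompact (isCompact_closedBall x r)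
  set k : ℝ → Rn n → ℝ := fun c y => c ^ n * g (c ^ 2 * ‖y - x‖ ^ 2) with hk
  set k' : ℝ → Rn n → ℝ := fun c y => n * c ^ (n - 1) * g (c ^ 2 * ‖y - x‖ ^ 2) +
    c ^ n * (g' (c ^ 2 * ‖y - x‖ ^ 2) * (2 * c * ‖y - x‖ ^ 2)) with hk'
  have hkd : ∀ c y, HasDerivAt (fun c => k c y) (k' c y) c := by
    intro c y
    have h1 := hasDerivAt_pow n c
    have h2 : HasDerivAt (fun c : ℝ => c ^ 2 * ‖y - x‖ ^ 2) (2 * c * ‖y - x‖ ^ 2) c := by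
      simpa using (hasDerivAt_pow 2 c).mul_const (‖y - x‖ ^ 2)
    exact h1.mul (HasDerivAt.comp c (hg _) h2)
  have hkc : ∀ c, Continuous (k c) := fun c => by simp only [hk]; fun_prop
  have hk'c : Continuous fun z : ℝ × Rn n => k' z.1 z.2 := by simp only [hk']; fun_prop
  have hkint : ∀ c, Integrable fun y => k c y * w y := by
    intro c
    have h : IntegrableOn (fun y => k c y * w y) (Metric.closedBall x r) :=
      hwi.integrableOn.continuousOn_mul (hkc c).continuousOn (isCompact_closedBall x r)
    rw [integrableOn_iff_integrable_of_support_subset] at h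
    · exact h
    · intro y hy
      by_contra hyB
      exact hy (by simp [hwdef, hyB])
  have hM : ∀ c, HasDerivAt (fun c => ∫ y, k c y * w y) (∫ y, k' c y * w y) c := by
    intro c
    obtain ⟨C, hC⟩ := ((isCompact_closedBall c 1).prod
      (isCompact_closedBall x r)).exists_bound_of_continuousOn hk'c.continuousOn
    refine (hasDerivAt_integral_of_dominated_loc_of_deriv_le
      (F := fun c y => k c y * w y) (F' := fun c y => k' c y * w y) (x₀ := c)
      (bound := fun y => C * ‖w y‖) (Metric.closedBall_mem_nhds c one_pos)
      (Eventually.of_forall fun c => (hkint c).aestronglyMeasurable) (hkint c) ?_ ?_ ?_ ?_).2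
    · have : Continuous (k' c) := by simp only [hk']; fun_prop
      exact this.aestronglyMeasurable.mul hwi.aestronglyMeasurable
    · refine Eventually.of_forall fun y d hd => ?_
      rw [norm_mul]
      by_cases hy : y ∈ Metric.closedBall x r
      · exact mul_le_mul_of_nonneg_right (hC (d, y) ⟨hd, hy⟩) (norm_nonneg _)
      · simp [hwdef, hy]
    · exact hwi.norm.const_mul C
    · exact Eventually.of_forall fun y d _ => (hkd d y).mul_const _
  -- For such `c` the function `ψ` built from `G` is supported in the given ball, hence admissible,
  -- and `k' c` is a nonpositive multiple of its Laplacian.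
  have hneg : ∀ c, r⁻¹ ≤ c → ∫ y, k' c y * w y ≤ 0 := by
    intro c hc
    have hc0 : 0 < c := (inv_pos.2 hr).trans_le hc
    set ψ : Rn n → ℝ := fun y => G (c ^ 2 * ‖y - x‖ ^ 2) with hψ
    have hsupp : tsupport ψ ⊆ Metric.closedBall x r := by
      refine closure_minimal (fun y hy => ?_) Metric.isClosed_closedBall
      by_contra hyB
      rw [Metric.mem_closedBall, dist_eq_norm, not_le] at hyB
      refine hy (hG1 _ ?_)
      have : 1 ≤ c * ‖y - x‖ := by
        calc (1 : ℝ) = r⁻¹ * r := (inv_mul_cancel₀ hr.ne').symm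
          _ ≤ c * ‖y - x‖ := mul_le_mul hc hyB.le hr.le hc0.le
      rw [← mul_pow]; exact one_le_pow₀ this
    have hψc : ContDiff ℝ 2 ψ := hG2.comp
      (contDiff_const.mul ((contDiff_id.sub contDiff_const).norm_sq ℝ))
    have h := hw ψ hψc (HasCompactSupport.of_support_subset_isCompact (isCompact_closedBall x r)
      ((subset_tsupport ψ).trans hsupp)) (hsupp.trans hB) fun y => hG0 _
    have heq : ∀ y, k' c y * w y = -(c ^ n / (2 * c ^ 3)) * (u y * lap ψ y) := by
      intro y
      by_cases hy : y ∈ Metric.closedBall x r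
      · simp only [hwdef, indicator_of_mem hy, hψ]
        rw [lap_radial hGd hg]
        simp only [hk']
        -- The exponent `n - 1` in `k'` is truncated, so dimension 0 is treated apart.
        rcases n with _ | n
        · simp; field_simp; ring
        · simp only [Nat.add_sub_cancel, pow_succ]; field_simp; ring
      · rw [lap_eq_zero_of_notMem_tsupport fun h => hy (hsupp h)]
        simp [hwdef, hy]
    simp only [heq]
    rw [integral_const_mul]
    exact mul_nonpos_of_nonpos_of_nonneg (neg_nonpos.2 (by positivity)) h
  have hanti : AntitoneOn (fun c => ∫ y, k c y * w y) (Ici r⁻¹) := by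
    refine antitoneOn_of_deriv_nonpos (convex_Ici _)
      (fun c _ => (hM c).continuousAt.continuousWithinAt)
      (fun c _ => (hM c).differentiableAt.differentiableWithinAt) fun c hc => ?_
    rw [(hM c).deriv]
    rw [interior_Ici] at hc
    exact hneg c hc.le
  set I := ∫ y : Rn n, g (‖y‖ ^ 2) with hIdef
  have hwx : w x = u x := indicator_of_mem (Metric.mem_closedBall_self hr.le) u
  have hwc : ContinuousAt w x := by
    refine hcx.congr ?_
    filter_upwards [Metric.closedBall_mem_nhds x hr] with y hy
    exact (indicator_of_mem hy u).symm
  -- The kernels divided by `I` form an approximate identity; only continuity of `u` at `x` is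
  -- needed for the limit.
  have hlim := tendsto_integral_comp_smul_smul_of_integrable' (μ := (volume : Measure (Rn n)))
    (φ := fun y => g (‖y‖ ^ 2) / I) (fun y => div_nonneg (hg0 _) hI.le)
    (by rw [integral_div, div_self hI.ne']) (by
      refine tendsto_const_nhds.congr' ?_
      filter_upwards [tendsto_norm_cobounded_atTop.eventually_gt_atTop 1] with y hy
      rw [hg1 _ (one_le_pow₀ hy.le)]; simp) hwi hwc
  rw [hwx] at hlim
  have hlim' : Tendsto (fun c => ∫ y, k c y * w y) atTop (𝓝 (u x * I)) := by
    refine (hlim.mul_const I).congr fun c => ?_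
    rw [← integral_mul_const]
    refine integral_congr_ae (Eventually.of_forall fun y => ?_)
    simp only [hk, finrank_euclideanSpace, Fintype.card_fin, norm_smul, mul_pow, smul_eq_mul,
      norm_sub_rev x y, Real.norm_eq_abs, sq_abs]
    field_simp
  refine le_of_tendsto hlim' ?_
  filter_upwards [eventually_ge_atTop r⁻¹] with c hc
  exact hanti self_mem_Ici hc hc

/-- Smooth profiles `g k` converging to the indicator of `t < 1` turn the kernel inequality into one
for the ball, by dominated convergence; the bounding sphere is null. -/
theorem le_average_closedBall {n : ℕ} {u : Rn n → ℝ} {Ω : Set (Rn n)} {x : Rn n} {r : ℝ}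
    (hw : WeaklySubharmonicOn u Ω) (hu : LocallyIntegrableOn u Ω) (hr : 0 < r)
    (hB : Metric.closedBall x r ⊆ Ω) (hcx : ContinuousAt u x) :
    u x ≤ ⨍ y in Metric.closedBall x r, u y := by
  set g : ℕ → ℝ → ℝ := fun k t => Real.smoothTransition (k * (1 - t)) with hg
  have hgsm : ∀ k, ContDiff ℝ 1 (g k) := fun k =>
    Real.smoothTransition.contDiff.comp (contDiff_const.mul (contDiff_const.sub contDiff_id))
  have hg0 : ∀ k t, 0 ≤ g k t := fun k t => Real.smoothTransition.nonneg _
  have hgle : ∀ k t, g k t ≤ 1 := fun k t => Real.smoothTransition.le_one _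
  have hg1 : ∀ k t, 1 ≤ t → g k t = 0 := fun k t ht =>
    Real.smoothTransition.zero_of_nonpos
      (mul_nonpos_of_nonneg_of_nonpos (Nat.cast_nonneg k) (by linarith))
  have hglim : ∀ t, Tendsto (fun k => g k t) atTop (𝓝 (if t < 1 then 1 else 0)) := by
    intro t
    split_ifs with ht
    · refine tendsto_const_nhds.congr' ?_
      obtain ⟨N, hN⟩ := exists_nat_gt (1 - t)⁻¹
      filter_upwards [eventually_ge_atTop N] with k hk
      refine (Real.smoothTransition.one_of_one_le ?_).symm
      have h1 : 0 < 1 - t := by linarith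
      calc (1 : ℝ) = (1 - t)⁻¹ * (1 - t) := (inv_mul_cancel₀ h1.ne').symm
        _ ≤ k * (1 - t) := by
          gcongr
          exact hN.le.trans (by exact_mod_cast hk)
    · exact tendsto_const_nhds.congr fun k => (hg1 k t (not_lt.1 ht)).symm
  set w := (Metric.closedBall x r).indicator u with hwdef
  have hwi : Integrable w := by
    rw [hwdef, integrable_indicator_iff Metric.isClosed_closedBall.measurableSet]
    exact (hu.mono_set hB).integrableOn_isCompact (isCompact_closedBall x r)
  have lim1 : Tendsto (fun k => ∫ y : Rn n, g k (‖y‖ ^ 2)) atTop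
      (𝓝 (∫ y : Rn n, (Metric.ball (0 : Rn n) 1).indicator (fun _ => (1 : ℝ)) y)) := by
    refine tendsto_integral_of_dominated_convergence
      ((Metric.closedBall (0 : Rn n) 1).indicator fun _ => (1 : ℝ)) (fun k => ?_) ?_
      (fun k => Eventually.of_forall fun y => ?_) (Eventually.of_forall fun y => ?_)
    · exact ((hgsm k).continuous.comp (by fun_prop)).aestronglyMeasurable
    · rw [integrable_indicator_iff Metric.isClosed_closedBall.measurableSet]
      exact integrableOn_const (isCompact_closedBall _ _).measure_ne_top
    · rw [Real.norm_of_nonneg (hg0 _ _)]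
      by_cases hy : y ∈ Metric.closedBall (0 : Rn n) 1
      · simpa [hy] using hgle k _
      · rw [indicator_of_notMem hy, hg1 k]
        have : 1 < ‖y‖ := by simpa using hy
        exact one_le_pow₀ this.le
    · convert hglim (‖y‖ ^ 2) using 2
      by_cases hy : ‖y‖ < 1 <;> simp [hy]
  have lim2 : Tendsto (fun k => ∫ y, (r⁻¹ ^ n * g k (r⁻¹ ^ 2 * ‖y - x‖ ^ 2)) * w y) atTop
      (𝓝 (∫ y, r⁻¹ ^ n * (Metric.ball x r).indicator u y)) := by
    refine tendsto_integral_of_dominated_convergence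
      (fun y => r⁻¹ ^ n * ‖w y‖) (fun k => ?_) (hwi.norm.const_mul _)
      (fun k => Eventually.of_forall fun y => ?_) (Eventually.of_forall fun y => ?_)
    · exact (continuous_const.mul
        ((hgsm k).continuous.comp (by fun_prop))).aestronglyMeasurable.mul hwi.aestronglyMeasurable
    · rw [norm_mul, Real.norm_of_nonneg (mul_nonneg (by positivity) (hg0 _ _))]
      gcongr
      exact mul_le_of_le_one_right (by positivity) (hgle _ _)
    · have h := ((hglim (r⁻¹ ^ 2 * ‖y - x‖ ^ 2)).const_mul (r⁻¹ ^ n)).mul_const (w y)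
      convert h using 2
      have hiff : r⁻¹ ^ 2 * ‖y - x‖ ^ 2 < 1 ↔ y ∈ Metric.ball x r := by
        rw [← mul_pow, sq_lt_one_iff₀ (by positivity), inv_mul_lt_one₀ hr, Metric.mem_ball,
          dist_eq_norm]
      by_cases hy : y ∈ Metric.ball x r
      · rw [if_pos (hiff.2 hy), indicator_of_mem hy, hwdef,
          indicator_of_mem (Metric.ball_subset_closedBall hy), mul_one]
      · rw [if_neg fun h => hy (hiff.1 h), indicator_of_notMem hy]; ring
  rw [integral_indicator_const _ Metric.isOpen_ball.measurableSet, smul_eq_mul, mul_one] at lim1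
  have hV : 0 < volume.real (Metric.ball (0 : Rn n) 1) :=
    ENNReal.toReal_pos (Metric.measure_ball_pos _ _ one_pos).ne' measure_ball_lt_top.ne
  have hmain := le_of_tendsto_of_tendsto (lim1.const_mul (u x)) lim2 (by
    filter_upwards [lim1.eventually (lt_mem_nhds hV)] with k hk
    exact mul_integral_radial_le hw hu hr hB hcx
      (fun t => ((hgsm k).differentiable (by simp) t).hasDerivAt)
      ((hgsm k).continuous_deriv le_rfl) (hg0 k) (hg1 k) hk)
  rw [integral_const_mul, integral_indicator Metric.isOpen_ball.measurableSet] at hmain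
  have hae : (Metric.ball x r : Set (Rn n)) =ᵐ[volume] Metric.closedBall x r :=
    ae_eq_of_subset_of_measure_ge Metric.ball_subset_closedBall
      (by rw [Measure.addHaar_closedBall _ _ hr.le, Measure.addHaar_ball_of_pos _ _ hr])
      Metric.isOpen_ball.measurableSet.nullMeasurableSet measure_closedBall_lt_top.ne
  rw [setIntegral_congr_set hae] at hmain
  rw [setAverage_eq, smul_eq_mul, Measure.addHaar_real_closedBall _ _ hr.le, finrank_euclideanSpace,
    Fintype.card_fin]
  rw [mul_inv, mul_right_comm, ← inv_pow, ← div_eq_mul_inv, le_div_iff₀ hV]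
  exact hmain

/-! ### Sign of the pointwise Laplacian -/

/-- Integrability makes the means of both parts finite, so the extended subtraction is the ordinary
one. -/
theorem ballMean_eq_average {n : ℕ} {v : Rn n → EReal} {u : Rn n → ℝ} {x : Rn n} {r : ℝ}
    (hr : 0 < r) (hu : IntegrableOn u (Metric.closedBall x r))
    (h : ∀ᵐ y ∂volume.restrict (Metric.closedBall x r), v y = (u y : EReal)) :
    ballMean v x r = ((⨍ y in Metric.closedBall x r, u y : ℝ) : EReal) := by
  set μ := volume.restrict (Metric.closedBall x r) with hμ
  have hμ0 : μ univ ≠ 0 := by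
    rw [hμ, Measure.restrict_apply_univ]
    exact (Metric.measure_closedBall_pos _ _ hr).ne'
  have hint : Integrable u ((μ univ)⁻¹ • μ) := hu.smul_measure (ENNReal.inv_ne_top.2 hμ0)
  have e1 : ⨍⁻ y, (v y).toENNReal ∂μ = ⨍⁻ y, ENNReal.ofReal (u y) ∂μ :=
    laverage_congr (h.mono fun y hy => by simp [hy])
  have e2 : ⨍⁻ y, (-(v y)).toENNReal ∂μ = ⨍⁻ y, ENNReal.ofReal (-u y) ∂μ :=
    laverage_congr (h.mono fun y hy => by
      change (-(v y)).toENNReal = ENNReal.ofReal (-u y)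
      rw [hy, ← EReal.coe_neg]; simp only [EReal.toENNReal_of_ne_top (EReal.coe_ne_top _),
        EReal.toReal_coe])
  rw [ballMean, e1, e2]
  have f1 : ⨍⁻ y, ENNReal.ofReal (u y) ∂μ ≠ ⊤ :=
    ne_of_lt (lt_of_le_of_lt (lintegral_mono fun y => ENNReal.ofReal_le_of_le_toReal (by
      simpa using le_abs_self (u y))) hint.2)
  have f2 : ⨍⁻ y, ENNReal.ofReal (-u y) ∂μ ≠ ⊤ :=
    ne_of_lt (lt_of_le_of_lt (lintegral_mono fun y => ENNReal.ofReal_le_of_le_toReal (by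
      simpa using neg_le_abs (u y))) hint.2)
  change _ = ((∫ y, u y ∂((μ univ)⁻¹ • μ) : ℝ) : EReal)
  rw [integral_eq_lintegral_pos_part_sub_lintegral_neg_part hint, EReal.coe_sub,
    EReal.coe_ennreal_toReal, EReal.coe_ennreal_toReal]
  all_goals first | rfl | assumption

theorem partialDeriv_const_mul_add {n : ℕ} (j : Fin n) {u h : Rn n → ℝ} {y : Rn n} (a b : ℝ)
    (hu : DifferentiableAt ℝ u y) (hh : DifferentiableAt ℝ h y) :
    partialDeriv j (fun y => a * u y + b * h y) y =
      a * partialDeriv j u y + b * partialDeriv j h y := by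
  simp only [partialDeriv]
  rw [hu.lineDeriv_eq_fderiv, hh.lineDeriv_eq_fderiv,
    ((hu.const_mul a).fun_add (hh.const_mul b)).lineDeriv_eq_fderiv,
    fderiv_fun_add (hu.const_mul a) (hh.const_mul b), fderiv_const_mul hu, fderiv_const_mul hh]
  simp

theorem lap_const_mul_add {n : ℕ} {U : Set (Rn n)} (hU : IsOpen U) {u h : Rn n → ℝ} (a b : ℝ)
    (hu : ContDiffOn ℝ 2 u U) (hh : ContDiffOn ℝ 2 h U) {y : Rn n} (hy : y ∈ U) :
    lap (fun y => a * u y + b * h y) y = a * lap u y + b * lap h y := by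
  simp only [lap, Finset.mul_sum, ← Finset.sum_add_distrib]
  refine Finset.sum_congr rfl fun j _ => ?_
  have e : partialDeriv j (fun y => a * u y + b * h y) =ᶠ[𝓝 y]
      fun y => a * partialDeriv j u y + b * partialDeriv j h y := by
    filter_upwards [hU.mem_nhds hy] with z hz
    exact partialDeriv_const_mul_add j a b
      ((hu.differentiableOn (by simp)).differentiableAt (hU.mem_nhds hz))
      ((hh.differentiableOn (by simp)).differentiableAt (hU.mem_nhds hz))
  rw [partialDeriv, e.lineDeriv_eq]
  exact partialDeriv_const_mul_add j a b
    (((contDiffOn_partialDeriv hU hu (k := 1) le_rfl).differentiableOn (by simp)).differentiableAt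
      (hU.mem_nhds hy))
    (((contDiffOn_partialDeriv hU hh (k := 1) le_rfl).differentiableOn (by simp)).differentiableAt
      (hU.mem_nhds hy))

theorem continuousOn_partialDeriv2 {n : ℕ} {U : Set (Rn n)} (hU : IsOpen U) {u : Rn n → ℝ}
    (hu : ContDiffOn ℝ 2 u U) (j : Fin n) :
    ContinuousOn (partialDeriv j (partialDeriv j u)) U :=
  (contDiffOn_partialDeriv (k := 0) hU (contDiffOn_partialDeriv (k := 1) hU hu le_rfl)
    le_rfl).continuousOn

/-- This is the case `E = ∅` of `integral_mul_lap_nonneg`, where continuity supplies local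
integrability. -/
theorem weaklySubharmonicOn_of_lap_nonneg {m : ℕ} {U : Set (Rn (m + 1))} (hU : IsOpen U)
    {u : Rn (m + 1) → ℝ} (hu : ContDiffOn ℝ 2 u U) (hlap : ∀ x ∈ U, 0 ≤ lap u x) :
    WeaklySubharmonicOn u U := by
  intro ψ hψ hψc hψU hψ0
  have hU' : IsOpen (U \ ∅) := by simpa using hU
  refine integral_mul_lap_nonneg (E := ∅) hU hU' (by simp)
    (hu.continuousOn.locallyIntegrableOn hU.measurableSet)
    (fun j => (continuousOn_partialDeriv2 hU hu j).locallyIntegrableOn hU.measurableSet)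
    (by simpa using hu) (fun j => Eventually.of_forall fun X => ?_) (by simpa using hlap)
    hψ hψc hψU hψ0
  have : lineSection (∅ : Set (Rn (m + 1))) j X = ∅ := rfl
  simp [this]

theorem lap_normSq {n : ℕ} (x y : Rn n) : lap (fun y => ‖y - x‖ ^ 2) y = 2 * n := by
  have := lap_radial (G := fun t => t) (g := fun _ => -1) (g' := fun _ => 0)
    (fun t => (hasDerivAt_id' t).congr_deriv (by simp)) (fun t => hasDerivAt_const t _) 1 x y
  simpa using this

/-- If the Laplacian were negative at `x`, then `w = -u - δ ‖y - x‖²` would have positive Laplacian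
near `x`. Its sub-mean value inequality makes `u x` strictly larger than a ball average of `u`,
against subharmonicity. -/
theorem lap_nonneg_of_subharmonicOn {m : ℕ} {U : Set (Rn (m + 1))} (hU : IsOpen U)
    {u : Rn (m + 1) → ℝ} (hu : ContDiffOn ℝ 2 u U)
    (hs : SubharmonicOn (fun x => (u x : EReal)) U) {x : Rn (m + 1)} (hx : x ∈ U) :
    0 ≤ lap u x := by
  by_contra! hneg
  -- As ‖y - x‖² has Laplacian `2 * (m + 1)`, this `δ` uses up exactly half of `-lap u x`.
  set δ : ℝ := -lap u x / (4 * (m + 1)) with hδ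
  have hδ0 : 0 < δ := by rw [hδ]; have : 0 < -lap u x := by linarith
                         positivity
  set h : Rn (m + 1) → ℝ := fun y => ‖y - x‖ ^ 2 with hh
  have hhc : ContDiff ℝ 2 h := (contDiff_id.sub contDiff_const).norm_sq ℝ
  set w : Rn (m + 1) → ℝ := fun y => (-1) * u y + (-δ) * h y with hw
  have hwc : ContDiffOn ℝ 2 w U :=
    (contDiffOn_const.mul hu).add (contDiffOn_const.mul hhc.contDiffOn)
  have hlw : ∀ y ∈ U, lap w y = -lap u y - δ * (2 * (m + 1)) := fun y hy => by
    rw [hw, lap_const_mul_add hU _ _ hu hhc.contDiffOn hy, hh, lap_normSq]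
    push_cast; ring
  have hcont : ContinuousAt (lap w) x :=
    (continuousOn_finsetSum _ fun j _ => continuousOn_partialDeriv2 hU hwc j).continuousAt
      (hU.mem_nhds hx)
  have hpos : 0 < lap w x := by
    rw [hlw x hx, hδ]
    have : -lap u x / (4 * (m + 1)) * (2 * (m + 1)) = -lap u x / 2 := by field_simp; ring
    rw [this]; linarith
  obtain ⟨ρ, hρ, hball⟩ := Metric.eventually_nhds_iff_ball.1
    ((hcont.eventually (lt_mem_nhds hpos)).and (hU.eventually_mem hx))
  have hwb : ContDiffOn ℝ 2 w (Metric.ball x ρ) := hwc.mono fun y hy => (hball y hy).2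
  have hρ2 : 0 < ρ / 2 := by linarith
  have hsub : Metric.closedBall x (ρ / 2) ⊆ Metric.ball x ρ :=
    Metric.closedBall_subset_ball (by linarith)
  have hsubU : Metric.closedBall x (ρ / 2) ⊆ U := fun y hy => (hball y (hsub hy)).2
  have h1 := le_average_closedBall (weaklySubharmonicOn_of_lap_nonneg Metric.isOpen_ball hwb
    fun y hy => (hball y hy).1.le)
    (hwb.continuousOn.locallyIntegrableOn Metric.isOpen_ball.measurableSet) hρ2 hsub
    (hwc.continuousOn.continuousAt (hU.mem_nhds hx))
  have hui : IntegrableOn u (Metric.closedBall x (ρ / 2)) :=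
    (hu.continuousOn.mono hsubU).integrableOn_compact (isCompact_closedBall _ _)
  have hhi : IntegrableOn h (Metric.closedBall x (ρ / 2)) :=
    hhc.continuous.continuousOn.integrableOn_compact (isCompact_closedBall _ _)
  have h2 := hs.le_ballMean x _ hρ2 hsubU
  rw [ballMean_eq_average hρ2 hui (Eventually.of_forall fun _ => rfl), EReal.coe_le_coe_iff] at h2
  have hV : 0 < volume.real (Metric.closedBall x (ρ / 2)) :=
    ENNReal.toReal_pos (Metric.measure_closedBall_pos _ _ hρ2).ne' measure_closedBall_lt_top.ne
  have hhpos : 0 < ∫ y in Metric.closedBall x (ρ / 2), h y := by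
    rw [setIntegral_pos_iff_support_of_nonneg_ae
      (Eventually.of_forall fun y => by simp only [hh]; positivity) hhi]
    have hsupp : Metric.closedBall x (ρ / 2) \ {x} ⊆ Function.support h ∩
        Metric.closedBall x (ρ / 2) := fun y hy => ⟨by
          simp only [hh, Function.mem_support]
          have : y - x ≠ 0 := sub_ne_zero.2 hy.2
          positivity, hy.1⟩
    refine lt_of_lt_of_le ?_ (measure_mono hsupp)
    rw [measure_sdiff_null (by simp)]
    exact Metric.measure_closedBall_pos _ _ hρ2
  rw [setAverage_eq, smul_eq_mul, ← div_eq_inv_mul, le_div_iff₀ hV] at h1 h2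
  have hwint : ∫ y in Metric.closedBall x (ρ / 2), w y =
      -(∫ y in Metric.closedBall x (ρ / 2), u y) -
        δ * ∫ y in Metric.closedBall x (ρ / 2), h y := by
    simp only [hw]
    rw [integral_add (hui.const_mul _) (hhi.const_mul _), integral_const_mul, integral_const_mul]
    ring
  rw [hwint] at h1
  have hwx : w x = -u x := by simp [hw, hh]
  rw [hwx] at h1
  have := mul_pos hδ0 hhpos
  linarith

/-! ### Finite Hausdorff measure and finite sections -/

theorem dist_le_dist_linePoint {m : ℕ} (j : Fin (m + 1)) (s t : ℝ) (X Y : Rn m) :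
    dist X Y ≤ dist (linePoint j s X) (linePoint j t Y) := by
  rw [EuclideanSpace.dist_eq, EuclideanSpace.dist_eq]
  refine Real.sqrt_le_sqrt ?_
  rw [Fin.sum_univ_succAbove _ j]
  simp only [linePoint, Fin.insertNth_apply_succAbove]
  exact le_add_of_nonneg_left (sq_nonneg _)

theorem edist_linePoint {m : ℕ} (j : Fin (m + 1)) (s t : ℝ) (X : Rn m) :
    edist (linePoint j s X) (linePoint j t X) = edist s t := by
  rw [edist_dist, edist_dist, linePoint_eq_add j t s X, dist_eq_norm, add_sub_cancel_left,
    norm_smul]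
  simp [dist_eq_norm]

/-- The projection of a bounded set along a coordinate axis lies in a measurable set whose volume
is controlled by the diameter. -/
theorem exists_measurableSet_projection {m : ℕ} (j : Fin (m + 1)) {S : Set (Rn (m + 1))}
    (hS : Metric.ediam S ≠ ⊤) :
    ∃ P : Set (Rn m), MeasurableSet P ∧ (∀ t X, linePoint j t X ∈ S → X ∈ P) ∧
      volume P ≤ (⨆ _ : S.Nonempty, Metric.ediam S ^ (m : ℝ)) *
        volume (Metric.ball (0 : Rn m) 1) := by
  by_cases h : ∃ t X, linePoint j t X ∈ S
  · obtain ⟨t₀, X₀, h₀⟩ := h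
    refine ⟨Metric.closedBall X₀ (Metric.ediam S).toReal, Metric.isClosed_closedBall.measurableSet,
      fun t X hX => ?_, ?_⟩
    · rw [Metric.mem_closedBall]
      refine (dist_le_dist_linePoint j t t₀ X X₀).trans ?_
      rw [dist_edist]
      exact ENNReal.toReal_mono hS (Metric.edist_le_ediam_of_mem hX h₀)
    · rw [Measure.addHaar_closedBall _ _ ENNReal.toReal_nonneg, finrank_euclideanSpace,
        Fintype.card_fin, ENNReal.ofReal_pow ENNReal.toReal_nonneg, ENNReal.ofReal_toReal hS,
        ciSup_pos ⟨_, h₀⟩, ENNReal.rpow_natCast]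
  · exact ⟨∅, MeasurableSet.empty, fun t X hX => h ⟨t, X, hX⟩, by simp⟩

/-- An Eilenberg-type argument: cover `E` by sets of small diameter and count how many projections
contain `X`. The integral of this count is bounded uniformly in the mesh, while the lower limit of
the counts dominates the number of points of `E` above `X`. -/
theorem ae_finite_lineSection {m : ℕ} {E : Set (Rn (m + 1))}
    (hE : (μHE[m] : Measure (Rn (m + 1))) E < ⊤) (j : Fin (m + 1)) :
    ∀ᵐ X : Rn m, (lineSection E j X).Finite := by
  -- The two normalisations of Hausdorff measure differ by a nonzero factor.
  have hH : (μH[(m : ℝ)] : Measure (Rn (m + 1))) E < ⊤ := by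
    rw [Measure.euclideanHausdorffMeasure_def, Measure.smul_apply, ENNReal.smul_def,
      smul_eq_mul] at hE
    by_contra htop
    rw [not_lt_top_iff.1 htop, ENNReal.mul_top (by
      simpa using Measure.addHaarScalarFactor_volume_hausdorffMeasure_ne_zero m)] at hE
    exact lt_irrefl _ hE
  set D := (μH[(m : ℝ)] : Measure (Rn (m + 1))) E + 1 with hD
  have hDt : D < ⊤ := ENNReal.add_lt_top.2 ⟨hH, ENNReal.one_lt_top⟩
  have hcov : ∀ k : ℕ, ∃ T : ℕ → Set (Rn (m + 1)), E ⊆ ⋃ i, T i ∧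
      (∀ i, Metric.ediam (T i) ≤ ((k + 1 : ℕ) : ENNReal)⁻¹) ∧
      ∑' i, ⨆ _ : (T i).Nonempty, Metric.ediam (T i) ^ (m : ℝ) ≤ D := by
    intro k
    have hlt : (μH[(m : ℝ)] : Measure (Rn (m + 1))) E < D :=
      ENNReal.lt_add_right hH.ne one_ne_zero
    rw [Measure.hausdorffMeasure_apply] at hlt
    have := (le_iSup₂ (f := fun (r : ENNReal) (_ : 0 < r) =>
      ⨅ (t : ℕ → Set (Rn (m + 1))) (_ : E ⊆ ⋃ n, t n) (_ : ∀ n, Metric.ediam (t n) ≤ r),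
          ∑' n, ⨆ _ : (t n).Nonempty, Metric.ediam (t n) ^ (m : ℝ))
      (((k + 1 : ℕ) : ENNReal)⁻¹) (ENNReal.inv_pos.2 (ENNReal.natCast_ne_top _))).trans_lt hlt
    simp only [iInf_lt_iff] at this
    obtain ⟨T, h1, h2, h3⟩ := this
    exact ⟨T, h1, h2, h3.le⟩
  choose T hTE hTd hTs using hcov
  have hne : ∀ k i, Metric.ediam (T k i) ≠ ⊤ := fun k i =>
    ne_top_of_le_ne_top (ENNReal.inv_ne_top.2 (by simp)) (hTd k i)
  choose P hPm hPT hPv using fun k i => exists_measurableSet_projection j (hne k i)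
  set g : ℕ → Rn m → ENNReal := fun k X => ∑' i, (P k i).indicator 1 X with hg
  have hgm : ∀ k, Measurable (g k) := fun k =>
    Measurable.tsum fun i => measurable_one.indicator (hPm k i)
  have hgint : ∀ k, ∫⁻ X, g k X ≤ D * volume (Metric.ball (0 : Rn m) 1) := by
    intro k
    simp only [hg]
    rw [lintegral_tsum fun i => (measurable_one.indicator (hPm k i)).aemeasurable]
    simp only [lintegral_indicator_one (hPm k _)]
    refine (ENNReal.tsum_le_tsum (hPv k)).trans ?_
    rw [ENNReal.tsum_mul_right]
    gcongr
    exact hTs k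
  -- Fatou's lemma, with the bound on ∫ `g k` independent of `k`.
  have hfin : ∫⁻ X, liminf (fun k => g k X) atTop ≠ ⊤ := by
    refine ne_top_of_le_ne_top (ENNReal.mul_ne_top hDt.ne
      (measure_ball_lt_top (μ := (volume : Measure (Rn m))) (x := 0) (r := 1)).ne)
      ((lintegral_liminf_le hgm).trans ?_)
    exact liminf_le_of_le (by isBoundedDefault) fun b hb => by
      obtain ⟨k, hk⟩ := hb.exists
      exact hk.trans (hgint k)
  filter_upwards [ae_lt_top (Measurable.liminf hgm) hfin] with X hX
  by_contra hinf
  have hbig : ∀ N : ℕ, (N : ENNReal) ≤ liminf (fun k => g k X) atTop := by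
    intro N
    obtain ⟨F, hFE, hFN⟩ := Set.Infinite.exists_subset_card_eq hinf N
    refine le_liminf_of_le (by isBoundedDefault) ?_
    have hlim : Tendsto (fun k : ℕ => ((k + 1 : ℕ) : ENNReal)⁻¹) atTop (𝓝 0) :=
      ENNReal.tendsto_inv_nat_nhds_zero.comp (tendsto_add_atTop_nat 1)
    -- Once the mesh is below the mutual distances in `F`, distinct points of `F` lie in distinct
    -- covering sets, so `g k X` is at least `N`.
    have hsep : ∀ᶠ k : ℕ in atTop, ∀ s ∈ F, ∀ t ∈ F, s ≠ t →
        ((k + 1 : ℕ) : ENNReal)⁻¹ < edist s t := by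
      refine (Finset.eventually_all F).2 fun s _ => (Finset.eventually_all F).2 fun t _ => ?_
      by_cases hst : s = t
      · simp [hst]
      · exact (hlim.eventually (gt_mem_nhds (edist_pos.2 hst))).mono fun k hk _ => hk
    filter_upwards [hsep] with k hk
    have hmem : ∀ t ∈ F, ∃ i, linePoint j t X ∈ T k i := fun t ht =>
      mem_iUnion.1 (hTE k (hFE ht))
    choose! ι hι using hmem
    have hinj : Set.InjOn ι F := by
      intro s hs t ht hst
      by_contra hne
      have h1 := Metric.edist_le_ediam_of_mem (hι s hs) (hst ▸ hι t ht)
      rw [edist_linePoint] at h1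
      exact absurd (hk s hs t ht hne) (not_lt.2 (h1.trans (hTd k _)))
    calc (N : ENNReal) = ∑ i ∈ F.image ι, 1 := by
          rw [Finset.sum_const, Finset.card_image_of_injOn hinj, hFN]; simp
      _ ≤ ∑ i ∈ F.image ι, (P k i).indicator 1 X := by
          refine Finset.sum_le_sum fun i hi => ?_
          obtain ⟨t, ht, rfl⟩ := Finset.mem_image.1 hi
          rw [indicator_of_mem (hPT k _ t X (hι t ht))]; simp
      _ ≤ g k X := ENNReal.sum_le_tsum _
  obtain ⟨N, hN⟩ := ENNReal.exists_nat_gt hX.ne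
  exact absurd (hbig N) (not_le.2 hN)

theorem volume_eq_zero_of_hausdorff_lt_top {m : ℕ} {E : Set (Rn (m + 1))}
    (hE : (μHE[m] : Measure (Rn (m + 1))) E < ⊤) : volume E = 0 := by
  rw [← EuclideanSpace.euclideanHausdorffMeasure_eq_volume]
  exact (Measure.euclideanHausdorffMeasure_zero_or_top (Nat.lt_succ_self m) E).resolve_right hE.ne

/-! ### Upper semicontinuous extension -/

theorem eventually_closedBall_subset {n : ℕ} {O : Set (Rn n)} (hO : IsOpen O) {x : Rn n} {r : ℝ}
    (hB : Metric.closedBall x r ⊆ O) : ∀ᶠ y in 𝓝 x, Metric.closedBall y r ⊆ O := by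
  obtain ⟨δ, hδ, hδO⟩ := (isCompact_closedBall x r).exists_thickening_subset_open hO hB
  filter_upwards [Metric.ball_mem_nhds x hδ] with y hy z hz
  refine hδO (Metric.mem_thickening_iff.2 ⟨z + (x - y), ?_, ?_⟩)
  · rw [Metric.mem_closedBall, dist_eq_norm] at hz ⊢
    rwa [show z + (x - y) - x = z - y by abel]
  · rw [Metric.mem_ball, dist_comm, dist_eq_norm] at hy
    rw [dist_eq_norm, show z - (z + (x - y)) = -(x - y) by abel, norm_neg]
    exact hy

/-- Indicators of the moving balls converge off the sphere of radius `r` about `x`, which is null,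
and all nearby balls stay in one compact subset of `Ω`. -/
theorem tendsto_setIntegral_closedBall {n : ℕ} {u : Rn n → ℝ} {Ω : Set (Rn n)} (hΩ : IsOpen Ω)
    (hu : LocallyIntegrableOn u Ω) {x : Rn n} {r : ℝ} (hr : 0 < r)
    (hB : Metric.closedBall x r ⊆ Ω) :
    Tendsto (fun y => ∫ z in Metric.closedBall y r, u z) (𝓝 x)
      (𝓝 (∫ z in Metric.closedBall x r, u z)) := by
  obtain ⟨K, hK, hBK, hKΩ⟩ := exists_compact_between (isCompact_closedBall x r) hΩ hB
  have hKi : IntegrableOn u K := (hu.mono_set hKΩ).integrableOn_isCompact hK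
  have hmem : ∀ᶠ y in 𝓝 x, Metric.closedBall y r ⊆ K :=
    (eventually_closedBall_subset isOpen_interior hBK).mono fun y hy => hy.trans interior_subset
  have hmeas : ∀ y, MeasurableSet (Metric.closedBall y r : Set (Rn n)) := fun y =>
    Metric.isClosed_closedBall.measurableSet
  simp only [← integral_indicator (hmeas _)]
  refine tendsto_integral_filter_of_dominated_convergence (K.indicator fun z => ‖u z‖) ?_ ?_ ?_ ?_
  · filter_upwards [hmem] with y hy
    exact ((hKi.mono_set hy).integrable_indicator (hmeas y)).aestronglyMeasurable
  · filter_upwards [hmem] with y hy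
    refine Eventually.of_forall fun z => ?_
    rw [norm_indicator_eq_indicator_norm]
    exact indicator_le_indicator_of_subset hy (fun _ => norm_nonneg _) z
  · exact (integrable_indicator_iff hK.measurableSet).2 hKi.norm
  · filter_upwards [compl_mem_ae_iff.2 (Measure.addHaar_sphere_of_ne_zero volume x hr.ne')]
      with z hz
    refine tendsto_const_nhds.congr' ?_
    have hc : Continuous fun y : Rn n => dist z y := by fun_prop
    rcases lt_or_gt_of_ne (show dist z x ≠ r from hz) with h | h
    · filter_upwards [hc.continuousAt.eventually (gt_mem_nhds h)] with y hy
      rw [indicator_of_mem (Metric.mem_closedBall.2 h.le),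
        indicator_of_mem (Metric.mem_closedBall.2 hy.le)]
    · filter_upwards [hc.continuousAt.eventually (lt_mem_nhds h)] with y hy
      rw [indicator_of_notMem fun h' => not_lt.2 (Metric.mem_closedBall.1 h') h,
        indicator_of_notMem fun h' => not_lt.2 (Metric.mem_closedBall.1 h') hy]

/-- A weakly subharmonic function which is continuous off a null set `E` has a subharmonic
representative that agrees with it off `E`. -/
theorem exists_subharmonicOn_extension {n : ℕ} {u : Rn n → ℝ} {Ω E : Set (Rn n)} (hΩ : IsOpen Ω)
    (hE : IsOpen (Ω \ E)) (hE0 : volume E = 0) (hu : LocallyIntegrableOn u Ω)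
    (hc : ContinuousOn u (Ω \ E)) (hw : WeaklySubharmonicOn u Ω) :
    ∃ v : Rn n → EReal, SubharmonicOn v Ω ∧ ∀ x ∈ Ω \ E, v x = (u x : EReal) := by
  classical
  set v : Rn n → EReal := fun x => if x ∈ Ω \ E then (u x : EReal) else
    limsup (fun y => (u y : EReal)) (𝓝[Ω \ E] x) with hv
  have hvu : ∀ x ∈ Ω \ E, v x = (u x : EReal) := fun x hx => if_pos hx
  have hvl : ∀ x, x ∉ Ω \ E → v x = limsup (fun y => (u y : EReal)) (𝓝[Ω \ E] x) :=
    fun x hx => if_neg hx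
  -- Off `E` this is `le_average_closedBall`; on `E` it follows by letting regular points tend to
  -- `x`. It also shows that `v` is below `⊤` on `Ω`.
  have hvA : ∀ x r, 0 < r → Metric.closedBall x r ⊆ Ω →
      v x ≤ ((⨍ y in Metric.closedBall x r, u y : ℝ) : EReal) := by
    intro x r hr hB
    by_cases hx : x ∈ Ω \ E
    · rw [hvu x hx, EReal.coe_le_coe_iff]
      exact le_average_closedBall hw hu hr hB (hc.continuousAt (hE.mem_nhds hx))
    rw [hvl x hx]
    have hlim : Tendsto (fun y => ((⨍ z in Metric.closedBall y r, u z : ℝ) : EReal)) (𝓝 x)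
        (𝓝 ((⨍ z in Metric.closedBall x r, u z : ℝ) : EReal)) := by
      refine (continuous_coe_real_ereal.tendsto _).comp ?_
      simp only [setAverage_eq, Measure.addHaar_real_closedBall _ _ hr.le]
      exact (tendsto_setIntegral_closedBall hΩ hu hr hB).const_smul _
    have hnear := eventually_closedBall_subset hΩ hB
    refine le_of_forall_gt_imp_ge_of_dense fun c hcx => limsup_le_of_le (by isBoundedDefault) ?_
    filter_upwards [nhdsWithin_le_nhds (hlim.eventually (gt_mem_nhds hcx)),
      nhdsWithin_le_nhds hnear, self_mem_nhdsWithin] with y hy1 hy2 hy3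
    refine le_trans ?_ hy1.le
    rw [EReal.coe_le_coe_iff]
    exact le_average_closedBall hw hu hr hy2 (hc.continuousAt (hE.mem_nhds hy3))
  refine ⟨v, ⟨fun x hx => ?_, fun x hx c hcx => ?_, fun x r hr hB => ?_⟩, hvu⟩
  · obtain ⟨r, hr, hrΩ⟩ := Metric.nhds_basis_closedBall.mem_iff.1 (hΩ.mem_nhds hx)
    exact (hvA x r hr hrΩ).trans_lt (EReal.coe_lt_top _)
  · change v x < c at hcx
    change ∀ᶠ y in 𝓝[Ω] x, v y < c
    refine nhdsWithin_le_nhds ?_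
    by_cases hxE : x ∈ Ω \ E
    · rw [hvu x hxE] at hcx
      have := (continuous_coe_real_ereal.continuousAt.comp
        (hc.continuousAt (hE.mem_nhds hxE))).eventually (gt_mem_nhds hcx)
      filter_upwards [this, hE.mem_nhds hxE] with y hy hyE
      rw [hvu y hyE]; exact hy
    -- The intermediate level `d` absorbs the loss of strictness: `u < d` at regular points near `x`
    -- only gives an upper limit `≤ d < c` at nearby points of `E`.
    · obtain ⟨d, hxd, hdc⟩ := exists_between hcx
      rw [hvl x hxE] at hxd
      have h1 := eventually_lt_of_limsup_lt hxd
      rw [eventually_nhdsWithin_iff] at h1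
      filter_upwards [eventually_eventually_nhds.2 h1] with y hy
      by_cases hyE : y ∈ Ω \ E
      · rw [hvu y hyE]; exact (hy.self_of_nhds hyE).trans hdc
      · rw [hvl y hyE]
        refine lt_of_le_of_lt (limsup_le_of_le (by isBoundedDefault) ?_) hdc
        rw [eventually_nhdsWithin_iff]
        exact hy.mono fun z hz hzE => (hz hzE).le
  · rw [ballMean_eq_average hr ((hu.mono_set hB).integrableOn_isCompact (isCompact_closedBall x r))]
    · exact hvA x r hr hB
    · rw [ae_restrict_iff' Metric.isClosed_closedBall.measurableSet]
      filter_upwards [compl_mem_ae_iff.2 hE0] with y hyE hyB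
      exact hvu y ⟨hB hyB, hyE⟩

end SubharmonicExtension

/-! ### Conclusion -/

theorem theorem1 (m : ℕ) (hm : 2 ≤ m + 1)
    (Ω E : Set (SubharmonicExtension.Rn (m + 1)))
    (hΩ_open : IsOpen Ω) (hΩ_conn : IsConnected Ω)
    (hE_sub : E ⊆ Ω) (hE_closed : IsClosed ((fun x : Ω => (x : SubharmonicExtension.Rn (m + 1))) ⁻¹' E))
    (hE_meas : (μHE[m] : Measure (SubharmonicExtension.Rn (m + 1))) E < ⊤)
    (u : SubharmonicExtension.Rn (m + 1) → ℝ)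
    (hu_sub : SubharmonicExtension.SubharmonicOn (fun x => (u x : EReal)) (Ω \ E))
    (hu_int : LocallyIntegrableOn u Ω volume)
    (hu_C2 : ContDiffOn ℝ 2 u (Ω \ E))
    (hu_int2 : ∀ j : Fin (m + 1), LocallyIntegrableOn
      (SubharmonicExtension.partialDeriv j (SubharmonicExtension.partialDeriv j u)) Ω volume)
    (hu_lines : ∀ j : Fin (m + 1),
      ∀ᵐ X ∂(μHE[m] : Measure (SubharmonicExtension.Rn m)),
        (SubharmonicExtension.lineSection E j X).Finite →
        ∀ t₀ ∈ SubharmonicExtension.lineSection E j X,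
          ∃ a b : ℕ → ℝ,
            (∀ l, a l ∈ SubharmonicExtension.lineSection (Ω \ E) j X) ∧
            (∀ l, b l ∈ SubharmonicExtension.lineSection (Ω \ E) j X) ∧
            Monotone a ∧ Tendsto a atTop (𝓝 t₀) ∧
            Antitone b ∧ Tendsto b atTop (𝓝 t₀) ∧
            (∃ c : ℝ,
              Tendsto (fun l => u (SubharmonicExtension.linePoint j (a l) X)) atTop (𝓝 c) ∧
              Tendsto (fun l => u (SubharmonicExtension.linePoint j (b l) X)) atTop (𝓝 c)) ∧
            (⊥ : EReal) < liminf (fun l => ((SubharmonicExtension.partialDeriv j u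
                (SubharmonicExtension.linePoint j (a l) X) : ℝ) : EReal)) atTop ∧
            liminf (fun l => ((SubharmonicExtension.partialDeriv j u
                (SubharmonicExtension.linePoint j (a l) X) : ℝ) : EReal)) atTop ≤
              limsup (fun l => ((SubharmonicExtension.partialDeriv j u
                (SubharmonicExtension.linePoint j (b l) X) : ℝ) : EReal)) atTop ∧
            limsup (fun l => ((SubharmonicExtension.partialDeriv j u
                (SubharmonicExtension.linePoint j (b l) X) : ℝ) : EReal)) atTop < (⊤ : EReal)) :
    ∃ v : SubharmonicExtension.Rn (m + 1) → EReal,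
      SubharmonicExtension.SubharmonicOn v Ω ∧ ∀ x ∈ Ω \ E, v x = (u x : EReal) := by
  have hopen : IsOpen (Ω \ E) := by
    have h := hΩ_open.isOpenEmbedding_subtypeVal.isOpenMap _ hE_closed.isOpen_compl
    convert h using 1
    ext x
    simp
  have hnull := SubharmonicExtension.volume_eq_zero_of_hausdorff_lt_top hE_meas
  refine SubharmonicExtension.exists_subharmonicOn_extension hΩ_open hopen hnull hu_int
    hu_C2.continuousOn fun ψ hψ hψc hψΩ hψ0 => ?_
  refine SubharmonicExtension.integral_mul_lap_nonneg hΩ_open hopen hnull hu_int hu_int2 hu_C2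
    (fun j => ?_)
    (fun x hx => SubharmonicExtension.lap_nonneg_of_subharmonicOn hopen hu_C2 hu_sub hx)
    hψ hψc hψΩ hψ0
  -- In ℝ^m the m-dimensional Hausdorff measure is Lebesgue measure, so this null set combines with
  -- the one from `ae_finite_lineSection`.
  have hl := hu_lines j
  rw [EuclideanSpace.euclideanHausdorffMeasure_eq_volume] at hl
  filter_upwards [hl, SubharmonicExtension.ae_finite_lineSection hE_meas j] with X hX hXf
  refine ⟨hXf, fun t ht => ?_⟩
  obtain ⟨a, b, h1, h2, h3, h4, h5, h6, h7, -, h9, -⟩ := hX hXf t ht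
  exact ⟨a, b, h1, h2, h3, h4, h5, h6, h7, h9⟩
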